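/- **Theorem 1.3.** For $n\ge 1$ let $K_n$ be the complete graph on $n$ vertices with a fixed origin. An $N$-step self-avoiding walk on $K_n$ is a sequence of $N+1$ distinct vertices of $K_n$ starting at the origin ($0\le N\le n-1$). For $z>0$, draw a walk $\omega$ among all self-avoiding walks on $K_n$ with probability proportional to $z^{|\omega|}$, where $|\omega|$ is its number of steps; let $L=|\omega|$ be its random length and $\mathbb E_z^{(n)}$ the expectation. Let $\Rightarrow$ denote convergence in distribution as $n\to\infty$, and let $\mathrm{erfc}(x)=\frac{2}{\sqrt\pi}\int_x^\infty e^{-t^2}\,dt$. (Where a formula for $z$ below is positive only for large $n$, only such $n$ are considered.) Let $\tau\in\mathbb R$, $a>0$ and $q\in(\frac12,1)$. 1. If $z=\frac1{sn}$ with $s>1$, then $L\Rightarrow G_{1-1/s}-1$, where $G_p$ is geometric with $P(G_p=k)=(1-p)^{k-1}p$ for $k=1,2,\dots$. 2. If $z=\frac1{n+an^q}$, then $L/n^{1-q}\Rightarrow W_a$, where $W_a$ is exponential with mean $1/a$. 3. If $z=\frac1{n+\tau\sqrt n}$, then $L/\sqrt n\Rightarrow X_\tau$, where $X_\tau$ is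 a real random variable (whose existence is part of the claim) with moment generating function, finite for all $t\in\mathbb R$, $$E\,e^{tX_\tau}=e^{-\tau t+t^2/2}\,\frac{\mathrm{erfc}\big((\tau-t)/\sqrt2\big)}{\mathrm{erfc}\big(\tau/\sqrt2\big)}.$$ 4. If $z=\frac1{n-an^q}$, then $L/n^q\Rightarrow a$. 5. If $z=\frac1{sn}$ with $0<s<1$, then $L/n\Rightarrow 1-s$. 6. More generally, if $r>\frac12$ and $(z_n)$ is a sequence of reals with $z_n>0$ and $\frac1{z_n}\le n-n^r$ for all sufficiently large $n$, then, for $z=z_n$, $L/\mathbb E_{z_n}^{(n)}(L)\Rightarrow 1$. -/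

import Mathlib

open MeasureTheory ProbabilityTheory Filter Topology

/-- Self-avoiding walks on the complete graph with vertex set `Fin n`, started at the
origin `o`: a number of steps `N ∈ {0, …, n - 1}` together with a sequence of `N + 1` distinct
vertices whose first vertex is `o`. (In a complete graph any two distinct vertices are adjacent.) -/
def SAW {n : ℕ} (o : Fin n) : Type :=
  Σ N : Fin n, {ω : Fin ((N : ℕ) + 1) → Fin n // ω 0 = o ∧ Function.Injective ω}

namespace SAW

/-- The number of steps of a walk. -/
def length {n : ℕ} {o : Fin n} (ω : SAW o) : ℕ := (ω.1 : ℕ)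

instance instFintype {n : ℕ} (o : Fin n) : Fintype (SAW o) :=
  inferInstanceAs (Fintype
    (Σ N : Fin n, {ω : Fin ((N : ℕ) + 1) → Fin n // ω 0 = o ∧ Function.Injective ω}))

instance instMeasurableSpace {n : ℕ} (o : Fin n) : MeasurableSpace (SAW o) := ⊤

instance instDiscreteMeasurableSpace {n : ℕ} (o : Fin n) : DiscreteMeasurableSpace (SAW o) :=
  ⟨fun _ => trivial⟩

/-- The zero-step walk. -/
def nil {n : ℕ} (o : Fin n) : SAW o :=
  ⟨⟨0, o.pos⟩, fun _ => o, rfl, fun i j _ => Subsingleton.elim (α := Fin 1) i j⟩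

/-- The weight `z ^ |ω|` of a walk, for `z > 0` (a value `z ≤ 0` is treated as `0`). -/
noncomputable def weight {n : ℕ} {o : Fin n} (z : ℝ) (ω : SAW o) : ENNReal :=
  ENNReal.ofReal z ^ ω.length

/-- The susceptibility, i.e. the total weight of all walks from the origin. -/
noncomputable def susceptibility {n : ℕ} (o : Fin n) (z : ℝ) : ENNReal :=
  ∑ ω : SAW o, weight z ω

theorem susceptibility_ne_zero {n : ℕ} (o : Fin n) (z : ℝ) : susceptibility o z ≠ 0 := by
  intro h
  have h1 := Finset.sum_eq_zero_iff.mp h (nil o) (Finset.mem_univ _)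
  simp [weight, length, nil] at h1

theorem susceptibility_ne_top {n : ℕ} (o : Fin n) (z : ℝ) : susceptibility o z ≠ ⊤ := by
  refine ENNReal.sum_ne_top.mpr fun ω _ => ?_
  exact ENNReal.pow_ne_top ENNReal.ofReal_ne_top

/-- The random walk: `ω` is drawn with probability `z ^ |ω| / χ`. -/
noncomputable def pmf {n : ℕ} (o : Fin n) (z : ℝ) : PMF (SAW o) :=
  PMF.ofFintype (fun ω => weight z ω / susceptibility o z) (by
    simp only [div_eq_mul_inv]
    rw [← Finset.sum_mul]
    exact ENNReal.mul_inv_cancel (susceptibility_ne_zero o z) (susceptibility_ne_top o z))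

/-- The law of the random walk, as a measure. -/
noncomputable def law {n : ℕ} (o : Fin n) (z : ℝ) : Measure (SAW o) := (pmf o z).toMeasure

instance instIsProbabilityMeasureLaw {n : ℕ} (o : Fin n) (z : ℝ) :
    IsProbabilityMeasure (law o z) :=
  inferInstanceAs (IsProbabilityMeasure (pmf o z).toMeasure)

/-- The mean length `E(L)` of the random walk. -/
noncomputable def meanLength {n : ℕ} (o : Fin n) (z : ℝ) : ℝ :=
  ∫ ω, (ω.length : ℝ) ∂(law o z)

end SAW

/-- The complementary error function on the real line. -/
noncomputable def erfc (x : ℝ) : ℝ :=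
  2 / Real.sqrt Real.pi * ∫ t in Set.Ioi x, Real.exp (-t ^ 2)

/-- The parameter `1 - 1/s ∈ [0, 1]`, for `s > 1`. -/
noncomputable def geomParam (s : ℝ) (hs : 1 < s) : unitInterval :=
  ⟨1 - 1 / s, by
    have h : 1 / s ≤ 1 := by
      rw [div_le_one (by linarith)]
      exact hs.le
    exact ⟨by linarith, by have : 0 < 1 / s := by positivity
                           linarith⟩⟩

/-- The law of a geometric random variable `G` with parameter `p`, the number of trials up to and
including the first success: `P(G = k) = (1 - p) ^ (k - 1) * p` for `k = 1, 2, …`.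
(Mathlib's `geometricMeasure` counts the failures before the first success.) -/
noncomputable def geomTrialsLaw (p : unitInterval) : Measure ℕ :=
  (geometricMeasure p).map (fun k => k + 1)

instance instIsProbabilityMeasureGeomTrialsLaw (p : unitInterval) :
    IsProbabilityMeasure (geomTrialsLaw p) :=
  Measure.isProbabilityMeasure_map (by fun_prop)

/-!
There are `(n - 1)! / (n - 1 - N)!` walks with `N` steps, so everything reduces to the explicit
weights `w N = z ^ N (n - 1)! / (n - 1 - N)!` of the lengths (`SAW.integral_law`).

In the subcritical and critical regimes one writes `w N = (n z) ^ N ∏_{j ≤ N} (1 - j / n)`. The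
product tends to `exp (- y ^ 2 / 2)` if `N / √n → y` (`SAW.tendsto_avoidProb`), while
`(n z) ^ N` with `n z = 1 / (1 + α / b)` and `N ∼ x b` tends to `exp (- α x)`. With the matching
exponential bounds on `w N`, dominated convergence gives the limit of `E f(L / b)`: a geometric
series for `b = 1`, and otherwise a Riemann sum for `∫ f ρ / ∫ ρ` on `(0, ∞)`
(`SAW.tendsto_integral_of_tendsto_stepWeight`). The density `ρ` is `exp (- a x)` if `b` is small
compared with `√n`, and `exp (- τ x - x ^ 2 / 2)` if `b = √n`: the critical limit is a Gaussian
variable with mean `-τ` and variance `1` conditioned to be positive. Completing the square gives its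
moment generating function (`integral_shiftedGaussian`).

In the supercritical regime, the number `n - 1 - L` of unvisited vertices is a Poisson variable
with mean `λ = 1 / z` conditioned to be less than `n`. Summation by parts yields
`E (L - (n - 1 - λ)) ^ 2 ≤ λ` as soon as `λ ≤ n` (`SAW.integral_sq_length_sub_le`), hence `L` is
within order `√n` of `n - λ`; this is negligible if `n - λ` is at least of order `n ^ q` with
`q > 1 / 2`, and mean square convergence implies convergence in distribution
(`SAW.tendstoInDistribution_supercritical`).
-/

/-! ### The law of the length -/

namespace SAW

/-- Dropping the fixed first vertex turns a self-avoiding walk with `N` steps into an embedding of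
`Fin N` into the remaining vertices. -/
def tailEquiv {n : ℕ} (o : Fin n) (N : ℕ) :
    {ω : Fin (N + 1) → Fin n // ω 0 = o ∧ Function.Injective ω} ≃
      (Fin N ↪ {x : Fin n // x ≠ o}) where
  toFun ω := ⟨fun i => ⟨ω.1 i.succ, fun h => Fin.succ_ne_zero i (ω.2.2 (h.trans ω.2.1.symm))⟩,
    fun i j h => Fin.succ_injective _ (ω.2.2 (congrArg Subtype.val h))⟩
  invFun e := ⟨Fin.cons o (fun i => (e i : Fin n)), rfl, by
    rw [Fin.cons_injective_iff]
    refine ⟨?_, fun i j h => e.injective (Subtype.ext h)⟩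
    rintro ⟨i, hi⟩
    exact (e i).2 hi⟩
  left_inv ω := by
    apply Subtype.ext
    funext i
    refine Fin.cases ?_ (fun j => ?_) i
    · exact ω.2.1.symm
    · rfl
  right_inv e := by
    ext i
    rfl

theorem card_steps {n : ℕ} (o : Fin n) (N : ℕ) :
    Fintype.card {ω : Fin (N + 1) → Fin n // ω 0 = o ∧ Function.Injective ω} =
      (n - 1).descFactorial N := by
  rw [Fintype.card_congr (tailEquiv o N), Fintype.card_embedding_eq, Fintype.card_fin]
  congr 1
  simp [Fintype.card_subtype_compl]

theorem sum_length {M : Type*} [AddCommMonoid M] {n : ℕ} (o : Fin n) (h : ℕ → M) :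
    ∑ ω : SAW o, h ω.length = ∑ N ∈ Finset.range n, (n - 1).descFactorial N • h N := by
  have h1 : ∑ ω : SAW o, h ω.length =
      ∑ N : Fin n, ∑ _ω : {ω : Fin ((N : ℕ) + 1) → Fin n // ω 0 = o ∧ Function.Injective ω},
        h (N : ℕ) :=
    Fintype.sum_sigma (fun x : (Σ N : Fin n,
      {ω : Fin ((N : ℕ) + 1) → Fin n // ω 0 = o ∧ Function.Injective ω}) => h (x.1 : ℕ))
  rw [h1, Finset.sum_range]
  refine Finset.sum_congr rfl fun N _ => ?_
  rw [Finset.sum_const, Finset.card_univ, card_steps]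

/-- The total weight `z ^ N (n - 1)! / (n - 1 - N)!` of the walks with `N` steps; it vanishes for
`N ≥ n`. -/
noncomputable def stepWeight (n : ℕ) (z : ℝ) (N : ℕ) : ℝ := (n - 1).descFactorial N * z ^ N

theorem stepWeight_zero (n : ℕ) (z : ℝ) : stepWeight n z 0 = 1 := by simp [stepWeight]

theorem stepWeight_nonneg (n : ℕ) {z : ℝ} (hz : 0 ≤ z) (N : ℕ) : 0 ≤ stepWeight n z N := by
  unfold stepWeight; positivity

theorem stepWeight_of_le {n : ℕ} (hn : 0 < n) (z : ℝ) {N : ℕ} (h : n ≤ N) :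
    stepWeight n z N = 0 := by
  rw [stepWeight, Nat.descFactorial_of_lt (by omega)]
  simp

theorem sum_stepWeight_pos {n : ℕ} (hn : 0 < n) {z : ℝ} (hz : 0 ≤ z) :
    0 < ∑ N ∈ Finset.range n, stepWeight n z N :=
  Finset.sum_pos' (fun N _ => stepWeight_nonneg n hz N)
    ⟨0, by simpa using hn, by simp [stepWeight_zero]⟩

/-- The length of the random walk has the law with weights `stepWeight n z`. -/
theorem integral_law {n : ℕ} (o : Fin n) {z : ℝ} (hz : 0 ≤ z) (g : ℕ → ℝ) :
    ∫ ω, g ω.length ∂(law o z) =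
      (∑ N ∈ Finset.range n, g N * stepWeight n z N) / ∑ N ∈ Finset.range n, stepWeight n z N := by
  have hχ : (susceptibility o z).toReal = ∑ N ∈ Finset.range n, stepWeight n z N := by
    rw [susceptibility, ENNReal.toReal_sum
      (fun ω _ => by unfold weight; exact ENNReal.pow_ne_top ENNReal.ofReal_ne_top)]
    simp only [weight, ENNReal.toReal_pow, ENNReal.toReal_ofReal hz]
    rw [sum_length o (fun N => z ^ N)]
    simp [stepWeight]
  rw [law, PMF.integral_eq_sum]
  have : ∀ ω : SAW o, ((pmf o z) ω).toReal • g ω.length =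
      (g ω.length * z ^ ω.length) / ∑ N ∈ Finset.range n, stepWeight n z N := by
    intro ω
    rw [pmf, PMF.ofFintype_apply, ENNReal.toReal_div, hχ, weight, ENNReal.toReal_pow,
      ENNReal.toReal_ofReal hz, smul_eq_mul]
    ring
  simp only [this]
  rw [← Finset.sum_div, sum_length o (fun N => g N * z ^ N)]
  congr 1
  refine Finset.sum_congr rfl fun N _ => ?_
  rw [stepWeight, nsmul_eq_mul]
  ring

theorem integrable_law {n : ℕ} (o : Fin n) (z : ℝ) (g : SAW o → ℝ) : Integrable g (law o z) :=
  Integrable.of_finite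

/-- Up to the factor `λ = 1 / z`, passing to one more step multiplies the weight by the number of
unvisited vertices. This holds for all `N < n`, with both sides `0` at `N = n - 1`. -/
theorem stepWeight_succ {n : ℕ} {z : ℝ} (hz : z ≠ 0) {N : ℕ} (hN : N < n) :
    (1 / z) * stepWeight n z (N + 1) = ((n : ℝ) - 1 - N) * stepWeight n z N := by
  have h : ((n - 1 - N : ℕ) : ℝ) = (n : ℝ) - 1 - N := by
    rw [Nat.sub_sub, Nat.cast_sub (by omega)]
    push_cast
    ring
  rw [stepWeight, stepWeight, Nat.descFactorial_succ]
  push_cast [h]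
  field_simp
  ring

/-- The number `n - 1 - L` of unvisited vertices is a Poisson variable with mean `λ = 1 / z`
conditioned to be less than `n`. As `λ ≤ n`, the conditioning does not increase the second moment
about `λ` beyond the Poisson variance `λ`. -/
theorem integral_sq_length_sub_le {n : ℕ} (o : Fin n) {z : ℝ} (hz : 0 < z) (hzn : 1 / z ≤ n) :
    ∫ ω, ((ω.length : ℝ) - (n - 1 - 1 / z)) ^ 2 ∂(law o z) ≤ 1 / z := by
  have hn : 0 < n := o.pos
  rw [integral_law o hz.le (fun N => ((N : ℝ) - (n - 1 - 1 / z)) ^ 2),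
    div_le_iff₀ (sum_stepWeight_pos hn hz.le)]
  set l := 1 / z with hl
  set w := stepWeight n z with hw
  -- With `D N = n - 1 - N - l` one has `D N * w N = l * (w (N + 1) - w N)`; summation by parts.
  have key : ∀ N ∈ Finset.range n, ((N : ℝ) - (n - 1 - l)) ^ 2 * w N =
      l * ((((n : ℝ) - 1 - (N + 1 : ℕ) - l) * w (N + 1) - ((n : ℝ) - 1 - N - l) * w N) +
        (w (N + 1) - w N) + w N) := by
    intro N hN
    have := stepWeight_succ hz.ne' (Finset.mem_range.mp hN)
    rw [← hl, ← hw] at this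
    push_cast
    linear_combination ((n : ℝ) - 1 - N - l) * (-this)
  rw [Finset.sum_congr rfl key, ← Finset.mul_sum, Finset.sum_add_distrib, Finset.sum_add_distrib,
    Finset.sum_range_sub (fun N : ℕ => ((n : ℝ) - 1 - N - l) * w N), Finset.sum_range_sub]
  have hwn : w n = 0 := stepWeight_of_le hn z le_rfl
  have hw0 : w 0 = 1 := stepWeight_zero n z
  have hl0 : 0 < l := by positivity
  rw [hwn, hw0]
  refine mul_le_mul_of_nonneg_left ?_ hl0.le
  push_cast
  linarith

end SAW

/-! ### Criteria for convergence in distribution -/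

theorem tendstoInDistribution_of_integral {ι Ω' : Type*} {Ω : ι → Type*}
    [∀ i, MeasurableSpace (Ω i)] [MeasurableSpace Ω'] {l : Filter ι} {X : ∀ i, Ω i → ℝ}
    {Z : Ω' → ℝ} {μ : ∀ i, Measure (Ω i)} [∀ i, IsProbabilityMeasure (μ i)] {μ' : Measure Ω'}
    [IsProbabilityMeasure μ'] (hX : ∀ i, AEMeasurable (X i) (μ i)) (hZ : AEMeasurable Z μ')
    (h : ∀ f : BoundedContinuousFunction ℝ ℝ,
      Tendsto (fun i => ∫ ω, f (X i ω) ∂(μ i)) l (𝓝 (∫ ω, f (Z ω) ∂μ'))) :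
    TendstoInDistribution X l Z μ μ' := by
  refine ⟨hX, hZ, ?_⟩
  refine ProbabilityMeasure.tendsto_iff_forall_integral_tendsto.mpr fun f => ?_
  have h1 : ∀ i, ∫ ω, f ω ∂((μ i).map (X i)) = ∫ ω, f (X i ω) ∂(μ i) := fun i =>
    integral_map (hX i) f.continuous.aestronglyMeasurable
  have h2 : ∫ ω, f ω ∂(μ'.map Z) = ∫ ω, f (Z ω) ∂μ' :=
    integral_map hZ f.continuous.aestronglyMeasurable
  simpa only [ProbabilityMeasure.coe_mk, h1, h2] using h f

theorem sq_integral_le_integral_sq {Ω : Type*} [MeasurableSpace Ω] {μ : Measure Ω}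
    [IsProbabilityMeasure μ] {g : Ω → ℝ} (hg : MemLp g 2 μ) :
    (∫ ω, g ω ∂μ) ^ 2 ≤ ∫ ω, g ω ^ 2 ∂μ := by
  have h := variance_nonneg g μ
  rw [variance_eq_sub hg] at h
  simpa using h

/-- Mean square convergence to a constant implies convergence in distribution, also when the
variables live on different probability spaces. -/
theorem tendstoInDistribution_const_of_integral_sq {ι : Type*} {Ω : ι → Type*}
    [∀ i, MeasurableSpace (Ω i)] {l : Filter ι} [l.IsCountablyGenerated] {X : ∀ i, Ω i → ℝ}
    {μ : ∀ i, Measure (Ω i)} [∀ i, IsProbabilityMeasure (μ i)] (hX : ∀ i, MemLp (X i) 2 (μ i))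
    {c : ℝ} (h : Tendsto (fun i => ∫ ω, (X i ω - c) ^ 2 ∂(μ i)) l (𝓝 0)) :
    TendstoInDistribution X l (fun x : ℝ => x) μ (Measure.dirac c) := by
  have hm : ∀ i, AEMeasurable (X i) (μ i) := fun i => (hX i).aestronglyMeasurable.aemeasurable
  refine ⟨hm, aemeasurable_id, ?_⟩
  refine tendsto_iff_forall_lipschitz_integral_tendsto.mpr ?_
  rintro f - ⟨K, hK⟩
  have h1 : ∀ i, ∫ ω, f ω ∂((μ i).map (X i)) = ∫ ω, f (X i ω) ∂(μ i) := fun i =>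
    integral_map (hm i) hK.continuous.aestronglyMeasurable
  have h2 : ∫ ω, f ω ∂((Measure.dirac c).map (fun x : ℝ => x)) = f c := by simp
  simp only [ProbabilityMeasure.coe_mk, h1, h2]
  have hs : Tendsto (fun i => K * √(∫ ω, (X i ω - c) ^ 2 ∂(μ i))) l (𝓝 0) := by
    simpa using (h.sqrt).const_mul (K : ℝ)
  refine tendsto_iff_dist_tendsto_zero.mpr
    (squeeze_zero (fun _ => dist_nonneg) (fun i => ?_) hs)
  have hd : MemLp (fun ω => X i ω - c) 2 (μ i) := (hX i).sub (memLp_const c)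
  have hdi : Integrable (fun ω => |X i ω - c|) (μ i) := (hd.integrable one_le_two).abs
  have hb : ∀ ω, ‖f (X i ω) - f c‖ ≤ K * |X i ω - c| := fun ω => by
    simpa [Real.dist_eq] using hK.dist_le_mul (X i ω) c
  have hfi' : Integrable (fun ω => f (X i ω) - f c) (μ i) :=
    (hdi.const_mul (K : ℝ)).mono'
      ((hK.continuous.comp_aestronglyMeasurable (hX i).aestronglyMeasurable).sub
        aestronglyMeasurable_const) (ae_of_all _ hb)
  have hfi : Integrable (fun ω => f (X i ω)) (μ i) :=
    (hfi'.add (integrable_const (f c))).congr (ae_of_all _ fun ω => by simp)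
  have h3 : ∫ ω, f (X i ω) ∂(μ i) - f c = ∫ ω, (f (X i ω) - f c) ∂(μ i) := by
    rw [integral_sub hfi (integrable_const _)]
    simp
  rw [Real.dist_eq, h3, ← Real.norm_eq_abs]
  refine (norm_integral_le_of_norm_le (hdi.const_mul (K : ℝ)) (ae_of_all _ hb)).trans ?_
  rw [integral_const_mul]
  refine mul_le_mul_of_nonneg_left (Real.le_sqrt_of_sq_le ?_) K.2
  simpa using sq_integral_le_integral_sq hd.abs

/-! ### The probability of self-avoidance -/

namespace SAW

/-- The proportion `(1 - 1 / n) (1 - 2 / n) ⋯ (1 - N / n)` of sequences of `N` vertices of `K_n`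
that can follow the origin in a self-avoiding walk. -/
noncomputable def avoidProb (n N : ℕ) : ℝ := (n - 1).descFactorial N / (n : ℝ) ^ N

theorem avoidProb_zero (n : ℕ) : avoidProb n 0 = 1 := by simp [avoidProb]

theorem avoidProb_nonneg (n N : ℕ) : 0 ≤ avoidProb n N := by unfold avoidProb; positivity

theorem stepWeight_eq {n : ℕ} (hn : 0 < n) (z : ℝ) (N : ℕ) :
    stepWeight n z N = avoidProb n N * (n * z) ^ N := by
  have : (n : ℝ) ≠ 0 := by positivity
  rw [stepWeight, avoidProb, mul_pow]
  field_simp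

theorem avoidProb_succ (n N : ℕ) :
    avoidProb n (N + 1) = avoidProb n N * (((n - 1 - N : ℕ) : ℝ) / n) := by
  rw [avoidProb, avoidProb, Nat.descFactorial_succ, pow_succ]
  push_cast
  rw [div_mul_div_comm, mul_comm (((n - 1 - N : ℕ) : ℝ))]

theorem avoidProb_le {n : ℕ} (hn : 0 < n) (N : ℕ) :
    avoidProb n N ≤ Real.exp (-((N : ℝ) ^ 2 / (2 * n))) := by
  have hn' : (0 : ℝ) < n := by positivity
  induction N with
  | zero => simp [avoidProb_zero]
  | succ N ih =>
    have hf : ((n - 1 - N : ℕ) : ℝ) / n ≤ Real.exp (-((2 * N + 1) / (2 * n))) := by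
      rcases le_or_gt n (N + 1) with h | h
      · rw [show n - 1 - N = 0 by omega]
        simpa using (Real.exp_pos _).le
      · rw [Nat.sub_sub, Nat.cast_sub (by omega)]
        push_cast
        refine le_trans ?_ (Real.add_one_le_exp _)
        rw [div_le_iff₀ hn']
        have : (-((2 * (N : ℝ) + 1) / (2 * n)) + 1) * n = n - N - 1 / 2 := by
          field_simp
          ring
        rw [this]
        linarith
    rw [avoidProb_succ]
    refine (mul_le_mul ih hf (by positivity) (Real.exp_pos _).le).trans (le_of_eq ?_)
    rw [← Real.exp_add]
    congr 1
    push_cast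
    field_simp
    ring

theorem le_avoidProb {n N : ℕ} (h : 2 * N ≤ n) :
    Real.exp (-((N : ℝ) * (N + 1) / (2 * n) + 2 * N ^ 3 / n ^ 2)) ≤ avoidProb n N := by
  induction N with
  | zero => simp [avoidProb_zero]
  | succ N ih =>
    have hn' : (0 : ℝ) < n := by
      have : 0 < n := by omega
      positivity
    have h2 : 2 * ((N : ℝ) + 1) ≤ n := by exact_mod_cast h
    set u : ℝ := ((N : ℝ) + 1) / n with hu
    have hu0 : 0 ≤ u := by positivity
    have hu1 : u ≤ 1 / 2 := by
      rw [hu, div_le_iff₀ hn']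
      linarith
    have hf : Real.exp (-(u + 2 * u ^ 2)) ≤ 1 - u := by
      rw [Real.exp_neg, inv_le_iff_one_le_mul₀ (Real.exp_pos _)]
      have h3 := Real.add_one_le_exp (u + 2 * u ^ 2)
      have h4 : (1 : ℝ) ≤ (1 - u) * (u + 2 * u ^ 2 + 1) := by nlinarith [sq_nonneg u]
      exact h4.trans (mul_le_mul_of_nonneg_left h3 (by linarith))
    have hc : ((n - 1 - N : ℕ) : ℝ) / n = 1 - u := by
      rw [Nat.sub_sub, Nat.cast_sub (by omega), hu]
      push_cast
      field_simp
      ring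
    rw [avoidProb_succ, hc]
    refine le_trans ?_ (mul_le_mul (ih (by omega)) hf (Real.exp_pos _).le (avoidProb_nonneg _ _))
    rw [← Real.exp_add, Real.exp_le_exp]
    have h5 : ((N : ℝ) + 1) * (N + 1 + 1) / (2 * n) = N * (N + 1) / (2 * n) + u := by
      rw [hu]
      field_simp
      ring
    have h6 : 2 * (N : ℝ) ^ 3 / n ^ 2 + 2 * u ^ 2 ≤ 2 * (N + 1) ^ 3 / n ^ 2 := by
      rw [hu, div_pow, ← mul_div_assoc, ← add_div]
      gcongr
      have : (0 : ℝ) ≤ N := by positivity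
      nlinarith [sq_nonneg (N : ℝ)]
    push_cast
    rw [h5]
    linarith

theorem tendsto_pnat_cast : Tendsto (fun n : ℕ+ => (n : ℝ)) atTop atTop :=
  tendsto_natCast_atTop_atTop.comp tendsto_PNat_val_atTop_atTop

theorem tendsto_sqrt_pnat : Tendsto (fun n : ℕ+ => √(n : ℝ)) atTop atTop :=
  Real.tendsto_sqrt_atTop.comp tendsto_pnat_cast

/-- The birthday problem: self-avoidance is felt after about `√n` steps. -/
theorem tendsto_avoidProb {N : ℕ+ → ℕ} {y : ℝ}
    (h : Tendsto (fun n : ℕ+ => (N n : ℝ) / √(n : ℝ)) atTop (𝓝 y)) :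
    Tendsto (fun n : ℕ+ => avoidProb n (N n)) atTop (𝓝 (Real.exp (-(y ^ 2 / 2)))) := by
  have hinv : Tendsto (fun n : ℕ+ => (√(n : ℝ))⁻¹) atTop (𝓝 0) :=
    tendsto_sqrt_pnat.inv_tendsto_atTop
  have hup : Tendsto (fun n : ℕ+ => Real.exp (-(((N n : ℝ) / √(n : ℝ)) ^ 2 / 2))) atTop
      (𝓝 (Real.exp (-(y ^ 2 / 2)))) :=
    (Real.continuous_exp.tendsto _).comp ((h.pow 2).div_const 2).neg
  have hlo : Tendsto (fun n : ℕ+ => Real.exp (-(((N n : ℝ) / √(n : ℝ)) ^ 2 / 2 +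
      (N n : ℝ) / √(n : ℝ) * (√(n : ℝ))⁻¹ / 2 +
        2 * (((N n : ℝ) / √(n : ℝ)) ^ 3 * (√(n : ℝ))⁻¹)))) atTop
      (𝓝 (Real.exp (-(y ^ 2 / 2)))) := by
    have := ((((h.pow 2).div_const 2).add ((h.mul hinv).div_const 2)).add
      (((h.pow 3).mul hinv).const_mul 2)).neg
    simp only [mul_zero, zero_div, add_zero] at this
    exact (Real.continuous_exp.tendsto _).comp this
  have hsmall : ∀ᶠ n : ℕ+ in atTop, 2 * N n ≤ (n : ℕ) := by
    have h0 : Tendsto (fun n : ℕ+ => (N n : ℝ) / √(n : ℝ) * (√(n : ℝ))⁻¹) atTop (𝓝 0) := by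
      simpa using h.mul hinv
    filter_upwards [h0.eventually (gt_mem_nhds (show (0 : ℝ) < 1 / 2 by norm_num))] with n hn
    have hn' : (0 : ℝ) < n := by exact_mod_cast n.pos
    rw [← div_eq_mul_inv, div_div, Real.mul_self_sqrt hn'.le, div_lt_iff₀ hn'] at hn
    have : (2 * N n : ℝ) ≤ (n : ℕ) := by linarith
    exact_mod_cast this
  refine tendsto_of_tendsto_of_tendsto_of_le_of_le' hlo hup ?_ ?_
  · filter_upwards [hsmall] with n hn
    refine le_trans (le_of_eq ?_) (le_avoidProb hn)
    have hn' : (0 : ℝ) < n := by exact_mod_cast n.pos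
    have hs : (0 : ℝ) < √(n : ℝ) := Real.sqrt_pos.mpr hn'
    congr 2
    have h4 : ((n : ℕ) : ℝ) = √(n : ℝ) ^ 2 := (Real.sq_sqrt hn'.le).symm
    rw [h4, Real.sqrt_sq hs.le]
    field_simp
  · refine Eventually.of_forall fun n => (avoidProb_le n.pos _).trans (le_of_eq ?_)
    rw [div_pow, Real.sq_sqrt (by positivity), div_div, mul_comm (2 : ℝ)]

/-! ### Scaling limits with a density -/

theorem integral_floor_eq_sum {n : ℕ} {h : ℕ → ℝ} (hh : ∀ N, n ≤ N → h N = 0) :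
    ∫ x in Set.Ioi (0 : ℝ), h ⌊x⌋₊ = ∑ N ∈ Finset.range n, h N := by
  have h1 : ∀ x ∈ Set.Ici (0 : ℝ), h ⌊x⌋₊ =
      ∑ N ∈ Finset.range n, (Set.Ico (N : ℝ) (N + 1)).indicator (fun _ => h N) x := by
    intro x hx
    have h2 : ∀ N : ℕ, (Set.Ico (N : ℝ) (N + 1)).indicator (fun _ => h N) x =
        if ⌊x⌋₊ = N then h N else 0 := by
      intro N
      simp only [Set.indicator_apply, Set.mem_Ico, ← Nat.floor_eq_iff (Set.mem_Ici.mp hx)]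
    simp only [h2, Finset.sum_ite_eq, Finset.mem_range]
    split_ifs with h3
    · rfl
    · exact hh _ (not_lt.mp h3)
  rw [← integral_Ici_eq_integral_Ioi, setIntegral_congr_fun measurableSet_Ici h1,
    integral_finsetSum]
  · refine Finset.sum_congr rfl fun N _ => ?_
    have h2 : Set.Ico (N : ℝ) (N + 1) ⊆ Set.Ici 0 := fun x hx => (Nat.cast_nonneg N).trans hx.1
    rw [setIntegral_indicator measurableSet_Ico, Set.inter_eq_right.mpr h2]
    simp
  · intro N _
    refine IntegrableOn.integrable_indicator ?_ measurableSet_Ico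
    refine integrableOn_const ?_
    exact ((Measure.restrict_apply_le _ _).trans_lt (by simp)).ne

theorem integral_floor_mul_eq_sum {n : ℕ} {h : ℕ → ℝ} (hh : ∀ N, n ≤ N → h N = 0) {b : ℝ}
    (hb : 0 < b) :
    ∫ x in Set.Ioi (0 : ℝ), h ⌊x * b⌋₊ = b⁻¹ * ∑ N ∈ Finset.range n, h N := by
  have := integral_comp_mul_right_Ioi (fun x => h ⌊x⌋₊) 0 hb
  rw [this, zero_mul, integral_floor_eq_sum hh, smul_eq_mul]

/-- Riemann sum principle: if the weights of the lengths, on the scale `b n`, converge to `ρ` under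
an exponential bound, then `L / b n` has asymptotic density proportional to `ρ` on `(0, ∞)`. -/
theorem tendsto_integral_of_tendsto_stepWeight (o : ∀ n : ℕ+, Fin (n : ℕ)) {z b : ℕ+ → ℝ}
    {ρ : ℝ → ℝ} {C c : ℝ} (hz : ∀ᶠ n in atTop, 0 < z n) (hb : Tendsto b atTop atTop) (hc : 0 < c)
    (hlim : ∀ x, 0 < x → Tendsto (fun n : ℕ+ => stepWeight n (z n) ⌊x * b n⌋₊) atTop (𝓝 (ρ x)))
    (hdom : ∀ᶠ n : ℕ+ in atTop, ∀ N : ℕ, stepWeight n (z n) N ≤ C * Real.exp (-c * (N / b n)))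
    (hpos : 0 < ∫ x in Set.Ioi 0, ρ x) (f : BoundedContinuousFunction ℝ ℝ) :
    Tendsto (fun n => ∫ ω, f ((ω.length : ℝ) / b n) ∂(law (o n) (z n))) atTop
      (𝓝 ((∫ x in Set.Ioi 0, f x * ρ x) / ∫ x in Set.Ioi 0, ρ x)) := by
  have key : ∀ g : BoundedContinuousFunction ℝ ℝ,
      Tendsto (fun n : ℕ+ => (b n)⁻¹ *
        ∑ N ∈ Finset.range n, g ((N : ℝ) / b n) * stepWeight n (z n) N) atTop
        (𝓝 (∫ x in Set.Ioi 0, g x * ρ x)) := by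
    intro g
    have h1 : Tendsto (fun n : ℕ+ => ∫ x in Set.Ioi (0 : ℝ),
        g ((⌊x * b n⌋₊ : ℝ) / b n) * stepWeight n (z n) ⌊x * b n⌋₊) atTop
        (𝓝 (∫ x in Set.Ioi 0, g x * ρ x)) := by
      refine tendsto_integral_filter_of_dominated_convergence
        (fun x => ‖g‖ * (C * Real.exp c * Real.exp (-c * x))) ?_ ?_ ?_ ?_
      · refine Eventually.of_forall fun n => Measurable.aestronglyMeasurable ?_
        exact (measurable_from_top (f := fun N : ℕ =>
          g ((N : ℝ) / b n) * stepWeight n (z n) N)).comp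
            (Nat.measurable_floor.comp (measurable_id.mul_const (b n)))
      · filter_upwards [hz, hdom, hb.eventually_ge_atTop 1] with n hzn hdn hbn
        refine (ae_restrict_mem measurableSet_Ioi).mono fun x hx => ?_
        have hb0 : 0 < b n := by linarith
        have hC : 0 ≤ C := by
          have := hdn 0
          rw [stepWeight_zero] at this
          simp at this
          linarith
        rw [norm_mul]
        refine mul_le_mul (g.norm_coe_le_norm _) ?_ (norm_nonneg _) (norm_nonneg _)
        rw [Real.norm_of_nonneg (stepWeight_nonneg _ hzn.le _)]
        refine (hdn _).trans ?_
        rw [mul_assoc, ← Real.exp_add]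
        refine mul_le_mul_of_nonneg_left (Real.exp_le_exp.mpr ?_) hC
        have h2 : x - 1 ≤ (⌊x * b n⌋₊ : ℝ) / b n := by
          rw [le_div_iff₀ hb0]
          have := Nat.lt_floor_add_one (x * b n)
          linarith
        nlinarith
      · exact ((exp_neg_integrableOn_Ioi 0 hc).const_mul _).const_mul _
      · refine (ae_restrict_mem measurableSet_Ioi).mono fun x hx => ?_
        refine Tendsto.mul ?_ (hlim x hx)
        exact (g.continuous.tendsto x).comp
          ((tendsto_nat_floor_mul_div_atTop (le_of_lt hx)).comp hb)
    refine h1.congr' ?_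
    filter_upwards [hb.eventually_gt_atTop 0] with n hbn
    refine integral_floor_mul_eq_sum (n := n)
      (h := fun N => g ((N : ℝ) / b n) * stepWeight n (z n) N) (fun N hN => ?_) hbn
    simp only [stepWeight_of_le n.pos _ hN, mul_zero]
  have h1 := key (BoundedContinuousFunction.const ℝ 1)
  simp only [BoundedContinuousFunction.const_apply, one_mul] at h1
  refine ((key f).div h1 hpos.ne').congr' ?_
  filter_upwards [hz, hb.eventually_gt_atTop 0] with n hzn hbn
  rw [integral_law (o n) hzn.le (fun N => f ((N : ℝ) / b n)), Pi.div_apply,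
    mul_div_mul_left _ _ (inv_pos.mpr hbn).ne']

theorem tendsto_inv_one_add_div_pow {ι : Type*} {l : Filter ι} {b : ι → ℝ}
    (hb : Tendsto b l atTop) (α : ℝ) {x : ℝ} (hx : 0 ≤ x) :
    Tendsto (fun i => ((1 + α / b i)⁻¹) ^ ⌊x * b i⌋₊) l (𝓝 (Real.exp (-(α * x)))) := by
  have h1 : Tendsto (fun i => b i * Real.log (1 + α / b i)) l (𝓝 α) :=
    (Real.tendsto_mul_log_one_add_div_atTop α).comp hb
  have h2 : Tendsto (fun i => (⌊x * b i⌋₊ : ℝ) / b i) l (𝓝 x) :=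
    (tendsto_nat_floor_mul_div_atTop hx).comp hb
  have h3 : Tendsto (fun i => 1 + α / b i) l (𝓝 1) := by
    simpa using (hb.const_div_atTop α).const_add 1
  refine ((Real.continuous_exp.tendsto _).comp (h1.mul h2).neg).congr' ?_
  filter_upwards [h3.eventually (lt_mem_nhds one_pos), hb.eventually_gt_atTop 0] with i hi hbi
  have : b i * Real.log (1 + α / b i) * ((⌊x * b i⌋₊ : ℝ) / b i) =
      ⌊x * b i⌋₊ * Real.log (1 + α / b i) := by field_simp
  rw [Function.comp_apply, this, inv_pow, Real.exp_neg, Real.exp_nat_mul, Real.exp_log hi]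

theorem inv_one_add_pow_le {u : ℝ} (hu : 0 < 1 + u) (N : ℕ) :
    ((1 + u)⁻¹) ^ N ≤ Real.exp (-(u / (1 + u) * N)) := by
  have h : (1 + u)⁻¹ ≤ Real.exp (-(u / (1 + u))) := by
    refine le_trans (le_of_eq ?_) (Real.add_one_le_exp _)
    field_simp
    ring
  refine (pow_le_pow_left₀ (inv_nonneg.mpr hu.le) h N).trans (le_of_eq ?_)
  rw [← Real.exp_nat_mul]
  ring_nf

end SAW

/-! ### The limit distributions -/

/-- The probability measure on `(0, ∞)` with density proportional to `ρ`. -/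
noncomputable def densityMeasure (ρ : ℝ → ℝ) : Measure ℝ :=
  (volume.restrict (Set.Ioi 0)).withDensity
    (fun x => ENNReal.ofReal (ρ x / ∫ y in Set.Ioi 0, ρ y))

section densityMeasure

variable {ρ : ℝ → ℝ}

theorem isProbabilityMeasure_densityMeasure (hi : IntegrableOn ρ (Set.Ioi 0)) (h0 : ∀ x, 0 ≤ ρ x)
    (hpos : 0 < ∫ x in Set.Ioi 0, ρ x) : IsProbabilityMeasure (densityMeasure ρ) := by
  constructor
  rw [densityMeasure, withDensity_apply _ MeasurableSet.univ, Measure.restrict_univ,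
    ← ofReal_integral_eq_lintegral_ofReal (hi.div_const _)
      (ae_of_all _ fun x => div_nonneg (h0 x) hpos.le), integral_div, div_self hpos.ne']
  simp

theorem integral_densityMeasure (hm : Measurable ρ) (h0 : ∀ x, 0 ≤ ρ x) (g : ℝ → ℝ) :
    ∫ x, g x ∂(densityMeasure ρ) = (∫ x in Set.Ioi 0, g x * ρ x) / ∫ x in Set.Ioi 0, ρ x := by
  have hI : 0 ≤ ∫ x in Set.Ioi 0, ρ x := integral_nonneg h0
  rw [densityMeasure, integral_withDensity_eq_integral_toReal_smul (by fun_prop)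
    (ae_of_all _ fun x => ENNReal.ofReal_lt_top), ← integral_div]
  refine integral_congr_ae (ae_of_all _ fun x => ?_)
  simp only [ENNReal.toReal_ofReal (div_nonneg (h0 x) hI), smul_eq_mul]
  ring

theorem integrable_densityMeasure (hm : Measurable ρ) (h0 : ∀ x, 0 ≤ ρ x) {g : ℝ → ℝ}
    (hg : IntegrableOn (fun x => g x * ρ x) (Set.Ioi 0)) : Integrable g (densityMeasure ρ) := by
  have hI : 0 ≤ ∫ x in Set.Ioi 0, ρ x := integral_nonneg h0
  rw [densityMeasure, integrable_withDensity_iff_integrable_smul' (by fun_prop)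
    (ae_of_all _ fun x => ENNReal.ofReal_lt_top)]
  refine (Integrable.div_const hg (∫ x in Set.Ioi 0, ρ x)).congr (ae_of_all _ fun x => ?_)
  simp only [ENNReal.toReal_ofReal (div_nonneg (h0 x) hI), smul_eq_mul]
  ring

end densityMeasure

theorem integral_exp_neg_mul_Ioi_zero {a : ℝ} (ha : 0 < a) :
    ∫ x in Set.Ioi (0 : ℝ), Real.exp (-(a * x)) = 1 / a := by
  have := integral_exp_mul_Ioi (a := -a) (by linarith) 0
  simpa [neg_mul] using this

theorem integral_expMeasure {a : ℝ} (ha : 0 < a) (g : ℝ → ℝ) :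
    ∫ x, g x ∂(expMeasure a) = (∫ x in Set.Ioi 0, g x * Real.exp (-(a * x))) /
      ∫ x in Set.Ioi 0, Real.exp (-(a * x)) := by
  have h : expMeasure a = volume.withDensity (exponentialPDF a) := rfl
  rw [h, integral_withDensity_eq_integral_toReal_smul
    (by unfold exponentialPDF; fun_prop) (ae_of_all _ fun x => by simp [exponentialPDF]),
    integral_exp_neg_mul_Ioi_zero ha, ← integral_div, ← integral_Ici_eq_integral_Ioi,
    ← integral_indicator measurableSet_Ici]
  refine integral_congr_ae (ae_of_all _ fun x => ?_)
  simp only [exponentialPDF_eq, smul_eq_mul]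
  rw [Set.indicator_apply]
  by_cases hx : 0 ≤ x
  · rw [if_pos hx, if_pos (Set.mem_Ici.mpr hx), ENNReal.toReal_ofReal (by positivity)]
    field_simp
  · rw [if_neg hx, if_neg (by simpa using hx)]
    simp

/-- The density, up to normalisation, of a Gaussian variable with mean `-τ` and variance `1`. -/
noncomputable def shiftedGaussian (τ x : ℝ) : ℝ := Real.exp (-(x ^ 2 / 2)) * Real.exp (-(τ * x))

theorem measurable_shiftedGaussian (τ : ℝ) : Measurable (shiftedGaussian τ) := by
  unfold shiftedGaussian; fun_prop

theorem shiftedGaussian_pos (τ x : ℝ) : 0 < shiftedGaussian τ x := by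
  unfold shiftedGaussian; positivity

theorem exp_mul_shiftedGaussian (τ t x : ℝ) :
    Real.exp (t * x) * shiftedGaussian τ x = shiftedGaussian (τ - t) x := by
  rw [shiftedGaussian, shiftedGaussian, ← Real.exp_add, ← Real.exp_add, ← Real.exp_add]
  congr 1
  ring

theorem integrable_shiftedGaussian (τ : ℝ) : Integrable (shiftedGaussian τ) := by
  have h := ((integrable_exp_neg_mul_sq (b := 1 / 2) (by norm_num)).comp_add_right τ).const_mul
    (Real.exp (τ ^ 2 / 2))
  refine h.congr (ae_of_all _ fun x => ?_)
  simp only [shiftedGaussian, ← Real.exp_add]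
  congr 1
  ring

theorem integral_shiftedGaussian_pos (τ : ℝ) : 0 < ∫ x in Set.Ioi 0, shiftedGaussian τ x := by
  rw [setIntegral_pos_iff_support_of_nonneg_ae
    (ae_of_all _ fun x => (shiftedGaussian_pos τ x).le) (integrable_shiftedGaussian τ).integrableOn]
  have : Function.support (shiftedGaussian τ) = Set.univ :=
    Set.eq_univ_of_forall fun x => (shiftedGaussian_pos τ x).ne'
  simp [this]

theorem integral_shiftedGaussian (τ : ℝ) :
    ∫ x in Set.Ioi 0, shiftedGaussian τ x =
      √2 * (√Real.pi / 2) * (Real.exp (τ ^ 2 / 2) * erfc (τ / √2)) := by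
  have h2 : (0 : ℝ) < √2 := by positivity
  have hπ : (0 : ℝ) < √Real.pi := Real.sqrt_pos.mpr Real.pi_pos
  have hsq : √(2 : ℝ) ^ 2 = 2 := Real.sq_sqrt (by norm_num)
  have h1 : ∀ x, shiftedGaussian τ x =
      Real.exp (τ ^ 2 / 2) * Real.exp (-((x + τ) * (√2)⁻¹) ^ 2) := by
    intro x
    rw [shiftedGaussian, ← Real.exp_add, ← Real.exp_add]
    congr 1
    rw [mul_pow, inv_pow, hsq]
    ring
  have hshift : ∫ x in Set.Ioi 0, Real.exp (-((x + τ) * (√2)⁻¹) ^ 2) =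
      ∫ x in Set.Ioi τ, Real.exp (-(x * (√2)⁻¹) ^ 2) := by
    have := (measurePreserving_add_right volume τ).setIntegral_preimage_emb
      (measurableEmbedding_addRight τ) (fun x => Real.exp (-(x * (√2)⁻¹) ^ 2)) (Set.Ioi τ)
    simpa using this
  have hscale := integral_comp_mul_right_Ioi (fun t => Real.exp (-t ^ 2)) τ (inv_pos.mpr h2)
  simp only [h1]
  rw [integral_const_mul, hshift, hscale, inv_inv, smul_eq_mul, erfc, ← div_eq_mul_inv]
  field_simp

namespace SAW

/-! ### Bounds and limits of the weights near criticality -/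

theorem tendsto_stepWeight_near_critical {z b : ℕ+ → ℝ} {α κ x : ℝ} (hx : 0 ≤ x)
    (hb : Tendsto b atTop atTop) (hz : ∀ n : ℕ+, (n : ℝ) * z n = (1 + α / b n)⁻¹)
    (hκ : Tendsto (fun n : ℕ+ => b n / √(n : ℝ)) atTop (𝓝 κ)) :
    Tendsto (fun n : ℕ+ => stepWeight n (z n) ⌊x * b n⌋₊) atTop
      (𝓝 (Real.exp (-((x * κ) ^ 2 / 2)) * Real.exp (-(α * x)))) := by
  have h1 : Tendsto (fun n : ℕ+ => (⌊x * b n⌋₊ : ℝ) / √(n : ℝ)) atTop (𝓝 (x * κ)) := by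
    refine (((tendsto_nat_floor_mul_div_atTop hx).comp hb).mul hκ).congr' ?_
    filter_upwards [hb.eventually_gt_atTop 0] with n hn
    simp only [Function.comp_apply]
    field_simp
  refine ((tendsto_avoidProb h1).mul (tendsto_inv_one_add_div_pow hb α hx)).congr fun n => ?_
  rw [stepWeight_eq n.pos, hz]

theorem stepWeight_le {n : ℕ} (hn : 0 < n) {z u : ℝ} (hu : 0 < 1 + u)
    (hz : (n : ℝ) * z = (1 + u)⁻¹) (N : ℕ) :
    stepWeight n z N ≤ Real.exp (-((N : ℝ) ^ 2 / (2 * n))) * Real.exp (-(u / (1 + u) * N)) := by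
  rw [stepWeight_eq hn, hz]
  exact mul_le_mul (avoidProb_le hn N) (inv_one_add_pow_le hu N) (by positivity)
    (Real.exp_pos _).le

/-! ### Concentration in the supercritical regime -/

theorem measurable_length_div {n : ℕ} (o : Fin n) (z β : ℝ) :
    AEMeasurable (fun ω : SAW o => (ω.length : ℝ) / β) (law o z) :=
  (measurable_of_finite _).aemeasurable

theorem integral_sq_length_div_sub_le {n : ℕ} (o : Fin n) {z : ℝ} (hz : 0 < z) (hzn : 1 / z ≤ n)
    {β : ℝ} (hβ : 0 < β) (c : ℝ) :
    ∫ ω, ((ω.length : ℝ) / β - c) ^ 2 ∂(law o z) ≤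
      2 * (n + ((n : ℝ) - 1 - 1 / z - c * β) ^ 2) / β ^ 2 := by
  set m : ℝ := (n : ℝ) - 1 - 1 / z with hm
  have h1 : ∀ ω : SAW o, ((ω.length : ℝ) / β - c) ^ 2 ≤
      2 / β ^ 2 * (((ω.length : ℝ) - m) ^ 2 + (m - c * β) ^ 2) := by
    intro ω
    have : ((ω.length : ℝ) / β - c) ^ 2 = ((ω.length : ℝ) - c * β) ^ 2 / β ^ 2 := by
      field_simp
    rw [this, div_mul_eq_mul_div]
    gcongr
    nlinarith [sq_nonneg (((ω.length : ℝ) - m) - (m - c * β))]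
  refine (integral_mono (integrable_law o z _) (integrable_law o z _) h1).trans ?_
  rw [integral_const_mul, integral_add (integrable_law o z _) (integrable_const _)]
  have h2 := (integral_sq_length_sub_le o hz hzn).trans hzn
  rw [← hm] at h2
  simp only [integral_const, probReal_univ, one_smul]
  rw [div_mul_eq_mul_div]
  gcongr

theorem tendsto_div_rpow_sq {q : ℝ} (hq : 1 / 2 < q) :
    Tendsto (fun n : ℕ+ => (n : ℝ) / ((n : ℝ) ^ q) ^ 2) atTop (𝓝 0) := by
  refine ((tendsto_rpow_neg_atTop (show 0 < 2 * q - 1 by linarith)).comp tendsto_pnat_cast).congr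
    fun n => ?_
  have hn : (0 : ℝ) < n := by exact_mod_cast n.pos
  rw [Function.comp_apply, ← Real.rpow_mul_natCast hn.le, neg_sub, Real.rpow_sub hn, Real.rpow_one]
  congr 2
  push_cast
  ring

/-- If `n - λ` is large compared with `√n`, then `L` concentrates around its typical value
`n - λ`, where `λ = 1 / z`. -/
theorem tendstoInDistribution_supercritical (o : ∀ n : ℕ+, Fin (n : ℕ)) {z β : ℕ+ → ℝ}
    {c δ q : ℝ} (hq : 1 / 2 < q) (hδ : 0 < δ)
    (hz : ∀ᶠ n : ℕ+ in atTop, 0 < z n ∧ 1 / z n ≤ (n : ℝ))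
    (hβ : ∀ᶠ n : ℕ+ in atTop, δ * (n : ℝ) ^ q ≤ β n)
    (hc : ∀ᶠ n : ℕ+ in atTop, ((n : ℝ) - 1 - 1 / z n - c * β n) ^ 2 ≤ n) :
    TendstoInDistribution (fun (n : ℕ+) (ω : SAW (o n)) => (ω.length : ℝ) / β n) atTop
      (fun x : ℝ => x) (fun n => law (o n) (z n)) (Measure.dirac c) := by
  refine tendstoInDistribution_const_of_integral_sq (fun n => MemLp.of_discrete) ?_
  have h0 : Tendsto (fun n : ℕ+ => 4 / δ ^ 2 * ((n : ℝ) / ((n : ℝ) ^ q) ^ 2)) atTop (𝓝 0) := by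
    simpa using (tendsto_div_rpow_sq hq).const_mul (4 / δ ^ 2)
  refine tendsto_of_tendsto_of_tendsto_of_le_of_le' tendsto_const_nhds h0
    (Eventually.of_forall fun n => integral_nonneg fun ω => sq_nonneg _) ?_
  filter_upwards [hz, hβ, hc] with n hzn hβn hcn
  have hn : (0 : ℝ) < n := by exact_mod_cast n.pos
  have hpos : 0 < δ * (n : ℝ) ^ q := mul_pos hδ (Real.rpow_pos_of_pos hn q)
  refine (integral_sq_length_div_sub_le (o n) hzn.1 hzn.2 (hpos.trans_le hβn) c).trans ?_
  calc 2 * ((n : ℝ) + ((n : ℝ) - 1 - 1 / z n - c * β n) ^ 2) / β n ^ 2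
      ≤ 2 * ((n : ℝ) + n) / (δ * (n : ℝ) ^ q) ^ 2 := by gcongr
    _ = 4 / δ ^ 2 * ((n : ℝ) / ((n : ℝ) ^ q) ^ 2) := by
      rw [mul_pow, div_mul_div_comm]
      ring

end SAW

namespace SAW

/-! ### Subcritical and critical limit laws -/

theorem tendstoInDistribution_subcritical (o : ∀ n : ℕ+, Fin (n : ℕ)) (s : ℝ) (hs : 1 < s) :
    TendstoInDistribution (fun (n : ℕ+) (ω : SAW (o n)) => (ω.length : ℝ)) atTop
      (fun k : ℕ => (k : ℝ) - 1)
      (fun n => law (o n) (1 / (s * (n : ℝ)))) (geomTrialsLaw (geomParam s hs)) := by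
  have hs0 : 0 < s := by linarith
  have hs1 : s⁻¹ < 1 := inv_lt_one_of_one_lt₀ hs
  have hsi : 0 ≤ s⁻¹ := by positivity
  have hp : ((geomParam s hs : unitInterval) : ℝ) = 1 - s⁻¹ := by simp [geomParam]
  have hp0 : geomParam s hs ≠ 0 := by
    intro h
    rw [h] at hp
    simp at hp
    linarith
  have hw : ∀ (n : ℕ+) (N : ℕ),
      stepWeight n (1 / (s * (n : ℝ))) N = avoidProb n N * s⁻¹ ^ N := by
    intro n N
    have hn : (0 : ℝ) < n := by exact_mod_cast n.pos
    rw [stepWeight_eq n.pos]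
    congr 2
    field_simp
  refine tendstoInDistribution_of_integral (fun n => (measurable_of_finite _).aemeasurable)
    measurable_from_top.aemeasurable fun f => ?_
  have key : ∀ g : BoundedContinuousFunction ℝ ℝ,
      Tendsto (fun n : ℕ+ => ∑ N ∈ Finset.range n, g N * stepWeight n (1 / (s * (n : ℝ))) N) atTop
        (𝓝 (∑' N : ℕ, g N * s⁻¹ ^ N)) := by
    intro g
    have h1 : Tendsto (fun n : ℕ+ => ∑' N : ℕ, g N * (avoidProb n N * s⁻¹ ^ N)) atTop
        (𝓝 (∑' N : ℕ, g N * s⁻¹ ^ N)) := by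
      refine tendsto_tsum_of_dominated_convergence (bound := fun N => ‖g‖ * s⁻¹ ^ N)
        ((summable_geometric_of_lt_one hsi hs1).mul_left _) (fun N => ?_)
        (Eventually.of_forall fun n N => ?_)
      · have h2 : Tendsto (fun n : ℕ+ => (N : ℝ) / √(n : ℝ)) atTop (𝓝 0) :=
          tendsto_sqrt_pnat.const_div_atTop _
        simpa using ((tendsto_avoidProb h2).mul_const (s⁻¹ ^ N)).const_mul (g N)
      · rw [norm_mul, Real.norm_of_nonneg (mul_nonneg (avoidProb_nonneg _ _) (by positivity))]
        refine mul_le_mul (g.norm_coe_le_norm _) (mul_le_of_le_one_left (by positivity) ?_)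
          (mul_nonneg (avoidProb_nonneg _ _) (by positivity)) (norm_nonneg _)
        refine (avoidProb_le n.pos N).trans (Real.exp_le_one_iff.mpr ?_)
        exact neg_nonpos.mpr (by positivity)
    refine h1.congr fun n => ?_
    simp only [← hw]
    refine tsum_eq_sum fun N hN => ?_
    rw [stepWeight_of_le n.pos _ (by simpa using hN), mul_zero]
  have hone := key (BoundedContinuousFunction.const ℝ 1)
  simp only [BoundedContinuousFunction.const_apply, one_mul,
    tsum_geometric_of_lt_one hsi hs1] at hone
  have hlim := (key f).div hone (inv_ne_zero (by linarith))
  have hZ : ∫ k : ℕ, f ((k : ℝ) - 1) ∂(geomTrialsLaw (geomParam s hs)) =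
      (∑' N : ℕ, f N * s⁻¹ ^ N) / (1 - s⁻¹)⁻¹ := by
    rw [geomTrialsLaw, integral_map (by fun_prop) measurable_from_top.aestronglyMeasurable,
      integral_geometricMeasure hp0, hp, div_inv_eq_mul, ← tsum_mul_right]
    refine tsum_congr fun N => ?_
    push_cast
    rw [smul_eq_mul, add_sub_cancel_right, sub_sub_cancel]
    ring
  rw [hZ]
  refine hlim.congr fun n => ?_
  exact (integral_law (o n) (z := 1 / (s * (n : ℝ))) (by positivity) (fun N => f N)).symm

theorem tendstoInDistribution_near_subcritical (o : ∀ n : ℕ+, Fin (n : ℕ)) {a q : ℝ} (ha : 0 < a)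
    (hq : 1 / 2 < q) (hq1 : q < 1) [IsProbabilityMeasure (expMeasure a)] :
    TendstoInDistribution
      (fun (n : ℕ+) (ω : SAW (o n)) => (ω.length : ℝ) / (n : ℝ) ^ (1 - q)) atTop
      (fun x : ℝ => x)
      (fun n => law (o n) (1 / ((n : ℝ) + a * (n : ℝ) ^ q))) (expMeasure a) := by
  have hn : ∀ n : ℕ+, (0 : ℝ) < n := fun n => by exact_mod_cast n.pos
  have hb : Tendsto (fun n : ℕ+ => (n : ℝ) ^ (1 - q)) atTop atTop :=
    (tendsto_rpow_atTop (by linarith)).comp tendsto_pnat_cast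
  have hz : ∀ n : ℕ+, (n : ℝ) * (1 / ((n : ℝ) + a * (n : ℝ) ^ q)) =
      (1 + a / (n : ℝ) ^ (1 - q))⁻¹ := by
    intro n
    have h1 := hn n
    have h2 := Real.rpow_pos_of_pos h1 q
    rw [Real.rpow_sub h1, Real.rpow_one]
    field_simp
  have hκ : Tendsto (fun n : ℕ+ => (n : ℝ) ^ (1 - q) / √(n : ℝ)) atTop (𝓝 0) := by
    refine ((tendsto_rpow_neg_atTop (show 0 < q - 1 / 2 by linarith)).comp tendsto_pnat_cast).congr
      fun n => ?_
    rw [Function.comp_apply, Real.sqrt_eq_rpow, ← Real.rpow_sub (hn n)]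
    congr 1
    ring
  refine tendstoInDistribution_of_integral (fun n => measurable_length_div _ _ _)
    aemeasurable_id fun f => ?_
  rw [integral_expMeasure ha]
  refine tendsto_integral_of_tendsto_stepWeight o (C := 1) (c := a / 2)
    (Eventually.of_forall fun n => ?_) hb (by linarith) (fun x hx => ?_) ?_ ?_ f
  · have h1 := hn n
    have h2 := Real.rpow_pos_of_pos h1 q
    positivity
  · simpa using tendsto_stepWeight_near_critical hx.le hb hz hκ
  · filter_upwards [hb.eventually_ge_atTop a] with n han N
    have hbn : (0 : ℝ) < (n : ℝ) ^ (1 - q) := Real.rpow_pos_of_pos (hn n) _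
    set b := (n : ℝ) ^ (1 - q)
    have hu0 : 0 < a / b := by positivity
    have hu1 : a / b ≤ 1 := (div_le_one hbn).mpr han
    refine (stepWeight_le n.pos (by linarith) (hz n) N).trans ?_
    refine mul_le_mul (Real.exp_le_one_iff.mpr (neg_nonpos.mpr (by positivity)))
      (Real.exp_le_exp.mpr ?_) (Real.exp_pos _).le zero_le_one
    have h1 : a / b / 2 ≤ a / b / (1 + a / b) :=
      div_le_div_of_nonneg_left hu0.le (by linarith) (by linarith)
    have h2 := mul_le_mul_of_nonneg_right h1 (Nat.cast_nonneg (α := ℝ) N)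
    have h3 : -(a / 2) * (N / b) = -(a / b / 2 * N) := by ring
    rw [h3]
    linarith
  · rw [integral_exp_neg_mul_Ioi_zero ha]
    positivity

theorem tendstoInDistribution_critical (o : ∀ n : ℕ+, Fin (n : ℕ)) (τ : ℝ)
    [IsProbabilityMeasure (densityMeasure (shiftedGaussian τ))] :
    TendstoInDistribution
      (fun (n : ℕ+) (ω : SAW (o n)) => (ω.length : ℝ) / √(n : ℝ)) atTop
      (fun x : ℝ => x)
      (fun n => law (o n) (1 / ((n : ℝ) + τ * √(n : ℝ))))
      (densityMeasure (shiftedGaussian τ)) := by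
  have hn : ∀ n : ℕ+, (0 : ℝ) < n := fun n => by exact_mod_cast n.pos
  have hs : ∀ n : ℕ+, (0 : ℝ) < √(n : ℝ) := fun n => Real.sqrt_pos.mpr (hn n)
  have hsq : ∀ n : ℕ+, √(n : ℝ) ^ 2 = n := fun n => Real.sq_sqrt (hn n).le
  have hb := tendsto_sqrt_pnat
  have hz : ∀ n : ℕ+, (n : ℝ) * (1 / ((n : ℝ) + τ * √(n : ℝ))) = (1 + τ / √(n : ℝ))⁻¹ := by
    intro n
    have h1 : (n : ℝ) + τ * √(n : ℝ) = n * (1 + τ / √(n : ℝ)) := by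
      have h2 := (hs n).ne'
      have h3 : (n : ℝ) * (τ / √(n : ℝ)) = τ * √(n : ℝ) := by
        nth_rewrite 1 [← hsq n]
        field_simp
      rw [mul_add, h3, mul_one]
    rw [h1, one_div, mul_inv, ← mul_assoc, mul_inv_cancel₀ (hn n).ne', one_mul]
  have hκ : Tendsto (fun n : ℕ+ => √(n : ℝ) / √(n : ℝ)) atTop (𝓝 1) :=
    tendsto_const_nhds.congr fun n => (div_self (hs n).ne').symm
  -- Once `√n` exceeds `2 |τ|`, the number `u = τ / √n` satisfies `1 + u ≥ 1 / 2`.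
  have hu : ∀ᶠ n : ℕ+ in atTop, 1 / 2 ≤ 1 + τ / √(n : ℝ) := by
    filter_upwards [hb.eventually_ge_atTop (2 * |τ|)] with n hτ
    have : -(1 / 2) ≤ τ / √(n : ℝ) := by
      rw [le_div_iff₀ (hs n)]
      linarith [neg_abs_le τ]
    linarith
  refine tendstoInDistribution_of_integral (fun n => measurable_length_div _ _ _)
    aemeasurable_id fun f => ?_
  rw [integral_densityMeasure (measurable_shiftedGaussian τ) fun x => (shiftedGaussian_pos τ x).le]
  refine tendsto_integral_of_tendsto_stepWeight o (C := Real.exp ((2 * |τ| + 1) ^ 2 / 2)) (c := 1)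
    ?_ hb one_pos (fun x hx => ?_) ?_ (integral_shiftedGaussian_pos τ) f
  · filter_upwards [hu] with n hun
    have : 0 < (n : ℝ) * (1 / ((n : ℝ) + τ * √(n : ℝ))) := by
      rw [hz]
      exact inv_pos.mpr (by linarith)
    exact pos_of_mul_pos_right this (hn n).le
  · simpa [shiftedGaussian] using tendsto_stepWeight_near_critical hx.le hb hz hκ
  · filter_upwards [hu] with n hun N
    refine (stepWeight_le n.pos (by linarith) (hz n) N).trans ?_
    rw [← Real.exp_add, ← Real.exp_add]
    refine Real.exp_le_exp.mpr ?_
    have hs' := hs n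
    set b := √(n : ℝ) with hbdef
    set y : ℝ := (N : ℝ) / b with hy
    have hy0 : 0 ≤ y := by positivity
    have h1 : (N : ℝ) ^ 2 / (2 * (n : ℝ)) = y ^ 2 / 2 := by
      rw [hy, ← hsq n, ← hbdef, div_pow]
      field_simp
    have h2 : τ / b / (1 + τ / b) * N = τ / (1 + τ / b) * y := by
      rw [hy]
      ring
    have h3 : -(2 * |τ|) ≤ τ / (1 + τ / b) := by
      rw [le_div_iff₀ (by linarith)]
      nlinarith [neg_abs_le τ, abs_nonneg τ]
    have h4 := mul_le_mul_of_nonneg_right h3 hy0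
    rw [h1, h2]
    nlinarith [sq_nonneg (y - (2 * |τ| + 1))]

/-! ### The mean length and the limit laws -/

theorem eventually_half_rpow_le {r : ℝ} (hr : 1 / 2 < r) :
    ∀ᶠ n : ℕ+ in atTop, (n : ℝ) ^ r / 2 ≤ (n : ℝ) ^ r - 1 - √(n : ℝ) := by
  have h : Tendsto (fun n : ℕ+ => (n : ℝ) ^ (r - 1 / 2)) atTop atTop :=
    (tendsto_rpow_atTop (by linarith)).comp tendsto_pnat_cast
  filter_upwards [h.eventually_ge_atTop 4] with n hn
  have h0 : (0 : ℝ) < n := by exact_mod_cast n.pos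
  have h1 : (1 : ℝ) ≤ √(n : ℝ) := Real.one_le_sqrt.mpr (by exact_mod_cast n.pos)
  rw [Real.rpow_sub h0, ← Real.sqrt_eq_rpow, le_div_iff₀ (by linarith)] at hn
  linarith

theorem sq_meanLength_sub_le {n : ℕ} (o : Fin n) {z : ℝ} (hz : 0 < z) (hzn : 1 / z ≤ n) :
    (meanLength o z - ((n : ℝ) - 1 - 1 / z)) ^ 2 ≤ n := by
  have h1 : meanLength o z - ((n : ℝ) - 1 - 1 / z) =
      ∫ ω, ((ω.length : ℝ) - ((n : ℝ) - 1 - 1 / z)) ∂(law o z) := by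
    rw [integral_sub (integrable_law o z _) (integrable_const _), meanLength]
    simp
  rw [h1]
  exact (sq_integral_le_integral_sq MemLp.of_discrete).trans
    ((integral_sq_length_sub_le o hz hzn).trans hzn)

end SAW

open SAW in
/-- Limit laws for the length of a random self-avoiding walk on the complete graph `K_n`. -/
theorem theorem1p3 (o : ∀ n : ℕ+, Fin (n : ℕ)) :
    -- subcritical
    (∀ (s : ℝ) (hs : 1 < s),
      TendstoInDistribution (fun (n : ℕ+) (ω : SAW (o n)) => (ω.length : ℝ)) atTop
        (fun k : ℕ => (k : ℝ) - 1)
        (fun n => SAW.law (o n) (1 / (s * (n : ℝ)))) (geomTrialsLaw (geomParam s hs))) ∧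
    -- subcritical, near critical
    (∀ (a q : ℝ) (ha : 0 < a), 1 / 2 < q → q < 1 →
      haveI : IsProbabilityMeasure (expMeasure a) := isProbabilityMeasure_expMeasure ha
      TendstoInDistribution
        (fun (n : ℕ+) (ω : SAW (o n)) => (ω.length : ℝ) / (n : ℝ) ^ (1 - q)) atTop
        (fun x : ℝ => x)
        (fun n => SAW.law (o n) (1 / ((n : ℝ) + a * (n : ℝ) ^ q))) (expMeasure a)) ∧
    -- critical window
    (∀ τ : ℝ, ∃ (ν : Measure ℝ) (_ : IsProbabilityMeasure ν),
      (∀ t : ℝ, Integrable (fun x => Real.exp (t * x)) ν ∧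
        mgf (fun x : ℝ => x) ν t =
          Real.exp (-τ * t + t ^ 2 / 2) *
            (erfc ((τ - t) / Real.sqrt 2) / erfc (τ / Real.sqrt 2))) ∧
      TendstoInDistribution
        (fun (n : ℕ+) (ω : SAW (o n)) => (ω.length : ℝ) / Real.sqrt (n : ℝ)) atTop
        (fun x : ℝ => x)
        (fun n => SAW.law (o n) (1 / ((n : ℝ) + τ * Real.sqrt (n : ℝ)))) ν) ∧
    -- supercritical, near critical
    (∀ a q : ℝ, 0 < a → 1 / 2 < q → q < 1 →
      TendstoInDistribution
        (fun (n : ℕ+) (ω : SAW (o n)) => (ω.length : ℝ) / (n : ℝ) ^ q) atTop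
        (fun x : ℝ => x)
        (fun n => SAW.law (o n) (1 / ((n : ℝ) - a * (n : ℝ) ^ q))) (Measure.dirac a)) ∧
    -- supercritical
    (∀ s : ℝ, 0 < s → s < 1 →
      TendstoInDistribution
        (fun (n : ℕ+) (ω : SAW (o n)) => (ω.length : ℝ) / (n : ℝ)) atTop
        (fun x : ℝ => x)
        (fun n => SAW.law (o n) (1 / (s * (n : ℝ)))) (Measure.dirac (1 - s))) ∧
    -- general supercritical case
    (∀ (r : ℝ) (z : ℕ+ → ℝ), 1 / 2 < r →
      (∀ᶠ n in atTop, 0 < z n ∧ 1 / z n ≤ (n : ℝ) - (n : ℝ) ^ r) →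
      TendstoInDistribution
        (fun (n : ℕ+) (ω : SAW (o n)) => (ω.length : ℝ) / SAW.meanLength (o n) (z n)) atTop
        (fun x : ℝ => x)
        (fun n => SAW.law (o n) (z n)) (Measure.dirac 1)) := by
  have hn : ∀ n : ℕ+, (0 : ℝ) < n := fun n => by exact_mod_cast n.pos
  have hn1 : ∀ n : ℕ+, (1 : ℝ) ≤ n := fun n => by exact_mod_cast n.pos
  refine ⟨tendstoInDistribution_subcritical o, ?_, ?_, ?_, ?_, ?_⟩
  · intro a q ha hq hq1
    have := isProbabilityMeasure_expMeasure ha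
    exact tendstoInDistribution_near_subcritical o ha hq hq1
  · intro τ
    have h0 : ∀ x, 0 ≤ shiftedGaussian τ x := fun x => (shiftedGaussian_pos τ x).le
    have hm := measurable_shiftedGaussian τ
    have hP := isProbabilityMeasure_densityMeasure (integrable_shiftedGaussian τ).integrableOn h0
      (integral_shiftedGaussian_pos τ)
    refine ⟨densityMeasure (shiftedGaussian τ), hP, fun t => ⟨?_, ?_⟩,
      tendstoInDistribution_critical o τ⟩
    · refine integrable_densityMeasure hm h0 ?_
      simp only [exp_mul_shiftedGaussian]
      exact (integrable_shiftedGaussian _).integrableOn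
    · rw [mgf, integral_densityMeasure hm h0]
      simp only [exp_mul_shiftedGaussian, integral_shiftedGaussian]
      rw [mul_div_mul_left _ _ (by positivity), mul_div_mul_comm, ← Real.exp_sub]
      congr 2
      ring
  · intro a q ha hq hq1
    refine tendstoInDistribution_supercritical o hq one_pos ?_
      (Eventually.of_forall fun n => (one_mul _).le) (Eventually.of_forall fun n => ?_)
    · have h : Tendsto (fun n : ℕ+ => (n : ℝ) ^ (1 - q)) atTop atTop :=
        (tendsto_rpow_atTop (by linarith)).comp tendsto_pnat_cast
      filter_upwards [h.eventually_gt_atTop a] with n han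
      have hq0 := Real.rpow_pos_of_pos (hn n) q
      rw [Real.rpow_sub (hn n), Real.rpow_one, lt_div_iff₀ hq0] at han
      refine ⟨one_div_pos.mpr (by linarith), ?_⟩
      rw [one_div_one_div]
      linarith [mul_pos ha hq0]
    · rw [one_div_one_div]
      have : (n : ℝ) - 1 - (n - a * (n : ℝ) ^ q) - a * (n : ℝ) ^ q = -1 := by ring
      rw [this]
      simpa using hn1 n
  · intro s hs hs1
    refine tendstoInDistribution_supercritical o (q := 1) (by norm_num) one_pos
      (Eventually.of_forall fun n => ⟨?_, ?_⟩) (Eventually.of_forall fun n => ?_)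
      (Eventually.of_forall fun n => ?_)
    · exact one_div_pos.mpr (mul_pos hs (hn n))
    · rw [one_div_one_div]
      exact mul_le_of_le_one_left (hn n).le hs1.le
    · simp
    · rw [one_div_one_div]
      have : (n : ℝ) - 1 - s * n - (1 - s) * n = -1 := by ring
      rw [this]
      simpa using hn1 n
  · intro r z hr hz
    have hz' : ∀ᶠ n : ℕ+ in atTop, 0 < z n ∧ 1 / z n ≤ (n : ℝ) := hz.mono fun n h =>
      ⟨h.1, h.2.trans (sub_le_self _ (Real.rpow_pos_of_pos (hn n) r).le)⟩
    have hc : ∀ᶠ n : ℕ+ in atTop,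
        ((n : ℝ) - 1 - 1 / z n - 1 * meanLength (o n) (z n)) ^ 2 ≤ n := by
      filter_upwards [hz'] with n h
      have := sq_meanLength_sub_le (o n) h.1 h.2
      rw [one_mul, ← neg_sq, neg_sub]
      exact this
    refine tendstoInDistribution_supercritical o (δ := 1 / 2) hr (by norm_num) hz' ?_ hc
    filter_upwards [hz, hc, eventually_half_rpow_le hr] with n h1 h2 h3
    have h4 := Real.le_sqrt_of_sq_le h2
    linarith [h1.2]
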